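/- Let $1\le p\le n$ be integers and let $\Omega\subset\mathbb{R}^n$ be an open set (not assumed bounded or connected) with smooth boundary: every $x\in\partial\Omega$ has an open neighbourhood $B$ with a $C^\infty$ function $\rho$ on $B$ such that $\Omega\cap B=\{\rho<0\}$, $\partial\Omega\cap B=\{\rho=0\}$, and $d\rho\neq 0$ on $\partial\Omega\cap B$. For an open set $X\subset\mathbb{R}^n$, a function $u\in C^\infty(X)$ is called $p$-plurisubharmonic if $\operatorname{tr}_W(D^2_xu)\ge 0$ for every $x\in X$ and every $p$-dimensional linear subspace $W\subset\mathbb{R}^n$, where $\operatorname{tr}_W$ denotes the trace of the restriction to $W$. The $p$-convex hull in $X$ of a compact set $K\subset X$ is $$\widehat K=\{x\in X:\ u(x)\le \sup_K u\ \text{ for all smooth $p$-plurisubharmonic functions } u \text{ on } X\},$$ and $X$ is called $p$-convex if $\widehat K$ is compact for every compact $K\subset X$. Suppose that $\Omega$ is locally $p$-convex, that is, every point $x\in\partial\Omega$ has an open neighbourhood $U$ in $\mathbb{R}^n$ such that $\Omega\cap U$ is $p$-convex. Then $\partial\Omega$ is $p$-convex: for every $x\in\partial\Omega$ and every $p$-dimensional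 linear subspace $W\subset T_x(\partial\Omega)$, $$\operatorname{tr}_W\bigl(II_{\partial\Omega,x}\bigr)\ \ge\ 0,$$ where $II_{\partial\Omega,x}(v,w)=-\langle\nabla_v \mathbf{n},w\rangle$ is the second fundamental form of $\partial\Omega$ with respect to the inward pointing unit normal field $\mathbf{n}$. -/

import Mathlib

open Set Filter Topology
open scoped ContDiff

noncomputable section

namespace PConvexity

variable {E : Type*} [NormedAddCommGroup E] [InnerProductSpace ℝ E] [FiniteDimensional ℝ E]

/-- The `W`-trace `tr_W B` of a bilinear form `B`: the trace, with respect to the inner product,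
of the restriction of `B` to the subspace `W`, computed in an orthonormal basis of `W`. -/
def traceOn (W : Submodule ℝ E) (B : LinearMap.BilinForm ℝ E) : ℝ :=
  ∑ i, B (stdOrthonormalBasis ℝ W i : E) (stdOrthonormalBasis ℝ W i : E)

/-- The `W`-trace does not depend on the orthonormal basis of `W`. -/
theorem traceOn_eq_sum {ι : Type*} [Fintype ι] (W : Submodule ℝ E)
    (B : LinearMap.BilinForm ℝ E) (b : OrthonormalBasis ι ℝ W) :
    traceOn W B = ∑ i, B (b i : E) (b i : E) := by
  let B' : LinearMap.BilinForm ℝ W := B.compl₁₂ W.subtype W.subtype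
  let T : W →ₗ[ℝ] W :=
    ((InnerProductSpace.toDual ℝ W).symm.toLinearEquiv.toLinearMap ∘ₗ
      (LinearMap.toContinuousLinearMap (𝕜 := ℝ) (E := W) (F' := ℝ)).toLinearMap) ∘ₗ B'
  have hT : ∀ v w : W, inner ℝ w (T v) = B v w := by
    intro v w
    rw [real_inner_comm]
    simp [T, B', InnerProductSpace.toDual_symm_apply]
  have h1 := T.trace_eq_sum_inner b
  have h2 := T.trace_eq_sum_inner (stdOrthonormalBasis ℝ W)
  simp only [hT] at h1 h2
  rw [traceOn, ← h1, ← h2]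

/-- The Hessian `D²u` of a function `u` at the point `x`, as a bilinear form. -/
def hessian (u : E → ℝ) (x : E) : LinearMap.BilinForm ℝ E :=
  (fderiv ℝ (fderiv ℝ u) x).toBilinForm

/-- The function `u` is smooth and `p`-plurisubharmonic on the open set `X`: its Hessian at each
point of `X` has nonnegative trace on every `p`-dimensional linear subspace. -/
def IsPPlurisubharmonicOn (p : ℕ) (X : Set E) (u : E → ℝ) : Prop :=
  ContDiffOn ℝ ∞ u X ∧
    ∀ x ∈ X, ∀ W : Submodule ℝ E, Module.finrank ℝ W = p → 0 ≤ traceOn W (hessian u x)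

/-- The `p`-convex hull of `K` in the open set `X`. -/
def pHull (p : ℕ) (X K : Set E) : Set E :=
  {x ∈ X | ∀ u : E → ℝ, IsPPlurisubharmonicOn p X u → (u x : EReal) ≤ ⨆ y ∈ K, (u y : EReal)}

/-- The open set `X` is `p`-convex: the `p`-convex hull in `X` of each compact subset of `X` is
compact. -/
def IsPConvex (p : ℕ) (X : Set E) : Prop :=
  ∀ K : Set E, K ⊆ X → IsCompact K → IsCompact (pHull p X K)

/-- The open set `Ω` is locally `p`-convex: every boundary point has an open neighbourhood `U` in
the ambient space such that `Ω ∩ U` is `p`-convex. -/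
def IsLocallyPConvex (p : ℕ) (Ω : Set E) : Prop :=
  ∀ x ∈ frontier Ω, ∃ U : Set E, IsOpen U ∧ x ∈ U ∧ IsPConvex p (Ω ∩ U)

/-- The open set `Ω` has smooth boundary: near each boundary point it has a smooth local defining
function, i.e. a smooth `ρ` on a neighbourhood `B` with `Ω ∩ B = {ρ < 0}`, `∂Ω ∩ B = {ρ = 0}` and
`dρ ≠ 0` on `∂Ω ∩ B`. -/
def HasSmoothBoundary (Ω : Set E) : Prop :=
  ∀ x ∈ frontier Ω, ∃ (B : Set E) (ρ : E → ℝ), IsOpen B ∧ x ∈ B ∧ ContDiffOn ℝ ∞ ρ B ∧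
    (∀ y ∈ B, y ∈ Ω ↔ ρ y < 0) ∧ (∀ y ∈ B, y ∈ frontier Ω ↔ ρ y = 0) ∧
    ∀ y ∈ B, y ∈ frontier Ω → fderiv ℝ ρ y ≠ 0

/-- `ν` is a unit vector orthogonal to `∂Ω` at `x` that points into `Ω`. The tangent space of the
smooth hypersurface `∂Ω` at `x` is its tangent cone there. -/
def IsInwardUnitNormal (Ω : Set E) (x ν : E) : Prop :=
  ‖ν‖ = 1 ∧ (∀ v ∈ tangentConeAt ℝ (frontier Ω) x, inner ℝ ν v = 0) ∧
    ∀ᶠ t : ℝ in 𝓝[>] 0, x + t • ν ∈ Ω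

open Classical in
/-- The inward pointing unit normal field of `∂Ω`. When `∂Ω` is smooth, there is exactly one inward
unit normal at each boundary point; elsewhere the value is irrelevant. -/
def inwardNormal (Ω : Set E) (x : E) : E :=
  if h : ∃ ν, IsInwardUnitNormal Ω x ν then h.choose else 0

/-- The second fundamental form `II(v, w) = -⟨∇_v n, w⟩` of `∂Ω` at `x`, where `n` is the inward
pointing unit normal field along `∂Ω`. Only its values on vectors tangent to `∂Ω` at `x` are
meaningful: there the derivative of `n` within `∂Ω` is the covariant derivative `∇_v n`. -/
def secondFundamentalForm (Ω : Set E) (x : E) : LinearMap.BilinForm ℝ E :=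
  -((innerₗ E) ∘ₗ (fderivWithin ℝ (inwardNormal Ω) (frontier Ω) x).toLinearMap)

/-- The boundary `∂Ω` is `p`-convex at `x`: the second fundamental form has nonnegative trace on
every `p`-plane that is tangent to `∂Ω` at `x`. -/
def BoundaryPConvexAt (p : ℕ) (Ω : Set E) (x : E) : Prop :=
  ∀ W : Submodule ℝ E, Module.finrank ℝ W = p → (W : Set E) ⊆ tangentConeAt ℝ (frontier Ω) x →
    0 ≤ traceOn W (secondFundamentalForm Ω x)

end PConvexity

end

noncomputable section

namespace PConvexity

variable {E : Type*} [NormedAddCommGroup E] [InnerProductSpace ℝ E]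

/-! Argue by contradiction. On tangent vectors the second fundamental form is `‖dρ‖⁻¹` times the
Hessian of `ρ` (`secondFundamentalForm_eq`), so suppose that this Hessian has negative trace on a
tangent `p`-plane at `x`. For small `c > 0` the function `g = ρ + c‖· - x‖²` keeps this property,
and by rotating the plane it holds at all nearby points, on `p`-planes tangent to the level sets of
`g` (`exists_perturbation`).

In a small closed ball of radius `r` about `x` let `K = {ρ ≤ -c r²}`, a compact subset of `Ω ∩ U`.
The part of `{g ≤ 0}` on the bounding sphere lies in `K`. The maximum principle
`IsPPlurisubharmonicOn.exists_mem_le` then puts every point of the ball with `g < 0` into the hull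
of `K`. The hull is compact and misses `x`, so `g ≥ 0 = g x` near `x`; hence `dρ = dg = 0` at `x`, a
contradiction. -/

/-! ### Second derivatives along lines -/

/-- The second-order necessary condition at a local maximum of a function of one variable. -/
theorem second_deriv_nonpos_of_isLocalMax {f f' : ℝ → ℝ} {L x : ℝ}
    (hf : ∀ᶠ t in 𝓝 x, HasDerivAt f (f' t) t) (hf' : HasDerivAt f' L x)
    (hmax : IsLocalMax f x) : L ≤ 0 := by
  by_contra! hL
  have hd : deriv f =ᶠ[𝓝 x] f' := hf.mono fun t ht => ht.deriv
  have hdd : deriv (deriv f) x = L := by rw [hd.deriv_eq, hf'.deriv]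
  -- If `L > 0`, then `x` is also a local minimum, so `f` is locally constant and `L = 0`.
  have hmin : IsLocalMin f x :=
    isLocalMin_of_deriv_deriv_pos (by rw [hdd]; exact hL) hmax.deriv_eq_zero
      hf.self_of_nhds.continuousAt
  have hconst : f =ᶠ[𝓝 x] fun _ => f x := by
    filter_upwards [hmax, hmin] with t h1 h2 using le_antisymm h1 h2
  have h0 : deriv (deriv f) x = 0 := by
    have h1 : deriv f =ᶠ[𝓝 x] fun _ => 0 := by simpa using hconst.deriv
    simpa using h1.deriv_eq
  linarith

theorem hessian_apply (u : E → ℝ) (x v w : E) :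
    hessian u x v w = fderiv ℝ (fderiv ℝ u) x v w := rfl

/-- The first derivative of a function along a line. -/
theorem eventually_hasDerivAt_line {u : E → ℝ} {x : E} (hu : ContDiffAt ℝ 2 u x) (w : E) :
    ∀ᶠ t : ℝ in 𝓝 0, HasDerivAt (fun t : ℝ => u (x + t • w)) (fderiv ℝ u (x + t • w) w) t := by
  have hc : Tendsto (fun t : ℝ => x + t • w) (𝓝 0) (𝓝 x) := by
    have : Continuous fun t : ℝ => x + t • w := by fun_prop
    simpa using this.tendsto 0
  filter_upwards [hc.eventually (hu.eventually (by simp))] with t ht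
  have h1 : HasDerivAt (fun t : ℝ => x + t • w) w t := by
    simpa using ((hasDerivAt_id t).smul_const w).const_add x
  exact (ht.differentiableAt (by simp)).hasFDerivAt.comp_hasDerivAt t h1

/-- The second derivative of a function along a line is given by its Hessian. -/
theorem hasDerivAt_fderiv_line {u : E → ℝ} {x : E} (hu : ContDiffAt ℝ 2 u x) (w : E) :
    HasDerivAt (fun t : ℝ => fderiv ℝ u (x + t • w) w) (hessian u x w w) 0 := by
  have h1 : HasDerivAt (fun t : ℝ => x + t • w) w 0 := by
    simpa using ((hasDerivAt_id (0 : ℝ)).smul_const w).const_add x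
  have h2 : HasFDerivAt (fderiv ℝ u) (fderiv ℝ (fderiv ℝ u) x) (x + (0 : ℝ) • w) := by
    rw [zero_smul, add_zero]
    exact ((hu.fderiv_right (m := 1) (by norm_num)).differentiableAt (by simp)).hasFDerivAt
  have h3 := h2.comp_hasDerivAt 0 h1
  simpa [hessian_apply] using h3.clm_apply (hasDerivAt_const (0 : ℝ) w)

/-- At a local maximum of `log (s - g) + k u`, the Hessians of `u` and `g` compare in the
directions tangent to the level set of `g`. -/
theorem hessian_le_of_isLocalMax_log {u g : E → ℝ} {x w : E} {s k : ℝ}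
    (hu : ContDiffAt ℝ 2 u x) (hg : ContDiffAt ℝ 2 g x) (hs : g x < s)
    (hmax : IsLocalMax (fun y => Real.log (s - g y) + k * u y) x) (hw : fderiv ℝ g x w = 0) :
    k * hessian u x w w ≤ hessian g x w w / (s - g x) := by
  have hc : Tendsto (fun t : ℝ => x + t • w) (𝓝 0) (𝓝 x) := by
    have : Continuous fun t : ℝ => x + t • w := by fun_prop
    simpa using this.tendsto 0
  have hlt : ∀ᶠ t : ℝ in 𝓝 0, g (x + t • w) < s :=
    hc.eventually (hg.continuousAt.eventually (gt_mem_nhds hs))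
  have hd : ∀ᶠ t : ℝ in 𝓝 0,
      HasDerivAt (fun t : ℝ => Real.log (s - g (x + t • w)) + k * u (x + t • w))
        (-fderiv ℝ g (x + t • w) w / (s - g (x + t • w)) + k * fderiv ℝ u (x + t • w) w) t := by
    filter_upwards [hlt, eventually_hasDerivAt_line hu w, eventually_hasDerivAt_line hg w]
      with t h0 h1 h2
    exact ((h2.const_sub s).log (by linarith)).add (h1.const_mul k)
  have hg0 : HasDerivAt (fun t : ℝ => s - g (x + t • w)) (-fderiv ℝ g (x + (0 : ℝ) • w) w) 0 :=
    (eventually_hasDerivAt_line hg w).self_of_nhds.const_sub s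
  have hne : s - g (x + (0 : ℝ) • w) ≠ 0 := by simpa using (sub_pos.2 hs).ne'
  have hd2 := ((hasDerivAt_fderiv_line hg w).neg.div hg0 hne).add
    ((hasDerivAt_fderiv_line hu w).const_mul k)
  have hmax' : IsLocalMax
      (fun t : ℝ => Real.log (s - g (x + t • w)) + k * u (x + t • w)) 0 := by
    have := hc.eventually hmax
    simpa [IsLocalMax, IsMaxFilter] using this
  have key := second_deriv_nonpos_of_isLocalMax hd hd2 hmax'
  have hpos : 0 < s - g x := sub_pos.2 hs
  -- The quadratic term in the second derivative of the logarithm contains `dg(w) = 0`.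
  simp only [Pi.neg_apply, zero_smul, add_zero, hw, neg_zero, mul_zero, sub_zero] at key
  have e : -hessian g x w w * (s - g x) / (s - g x) ^ 2 = -(hessian g x w w / (s - g x)) := by
    field_simp
  rw [e] at key
  linarith

/-! ### Rotations of hyperplanes -/

/-- On the orthogonal complement of the unit vector `a`, this is the rotation in the plane of `a`
and `b` that takes `a` to the unit vector `b`. -/
def rotate (a b v : E) : E := v - (inner ℝ b v / (1 + inner ℝ a b)) • (a + b)

/-- Since `‖a + b‖² = 2 (1 + ⟨a, b⟩)`, the quadratic correction cancels the two cross terms. -/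
theorem inner_rotate_rotate {a b v w : E} (ha : ‖a‖ = 1) (hb : ‖b‖ = 1)
    (hab : 1 + inner ℝ a b ≠ 0) (hv : inner ℝ a v = 0) (hw : inner ℝ a w = 0) :
    inner ℝ (rotate a b v) (rotate a b w) = inner ℝ v w := by
  have ha' : inner ℝ a a = 1 := by simp [ha]
  have hb' : inner ℝ b b = 1 := by simp [hb]
  simp only [rotate, inner_sub_left, inner_sub_right, inner_add_left, inner_add_right,
    inner_smul_left, inner_smul_right, ha', hb', hv, hw, real_inner_comm a b,
    real_inner_comm a v, real_inner_comm b v, conj_trivial]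
  rw [real_inner_comm b a] at *
  field_simp
  ring

theorem inner_rotate {a b v : E} (hb : ‖b‖ = 1) (hab : 1 + inner ℝ a b ≠ 0) :
    inner ℝ b (rotate a b v) = 0 := by
  have hb' : inner ℝ b b = 1 := by simp [hb]
  simp only [rotate, inner_sub_right, inner_add_right, inner_smul_right, hb']
  rw [real_inner_comm b a] at *
  field_simp
  ring

theorem rotate_self {a v : E} (hv : inner ℝ a v = 0) : rotate a a v = v := by
  simp [rotate, hv]

/-! ### Derivatives of the quadratic perturbation -/

theorem fderiv_add_mul_norm_sq {ρ : E → ℝ} {y : E} (hρ : DifferentiableAt ℝ ρ y) (c : ℝ) (x : E) :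
    fderiv ℝ (fun z => ρ z + c * ‖z - x‖ ^ 2) y =
      fderiv ℝ ρ y + (2 * c) • innerSL ℝ (y - x) := by
  have h := (((hasFDerivAt_id (𝕜 := ℝ) y).sub_const x).norm_sq).const_mul c
  have h2 := (hρ.hasFDerivAt.add h).fderiv
  refine h2.trans ?_
  ext v
  simp
  ring

theorem hessian_add_mul_norm_sq {ρ : E → ℝ} {x : E} (hρ : ContDiffAt ℝ 2 ρ x) (c : ℝ) (v w : E) :
    hessian (fun z => ρ z + c * ‖z - x‖ ^ 2) x v w = hessian ρ x v w + 2 * c * inner ℝ v w := by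
  have h1 : fderiv ℝ (fun z => ρ z + c * ‖z - x‖ ^ 2) =ᶠ[𝓝 x]
      fun y => fderiv ℝ ρ y + (2 * c) • innerSL ℝ (y - x) := by
    filter_upwards [hρ.eventually (by simp)] with y hy
      using fderiv_add_mul_norm_sq (hy.differentiableAt (by simp)) c x
  have h2 : HasFDerivAt (fderiv ℝ ρ) (fderiv ℝ (fderiv ℝ ρ) x) x :=
    ((hρ.fderiv_right (m := 1) (by norm_num)).differentiableAt (by simp)).hasFDerivAt
  have h3 : HasFDerivAt (fun y : E => innerSL ℝ (y - x)) (innerSL ℝ) x :=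
    (innerSL ℝ : E →L[ℝ] E →L[ℝ] ℝ).hasFDerivAt.comp x ((hasFDerivAt_id x).sub_const x)
  have h4 := h2.add (h3.const_smul (2 * c))
  rw [hessian_apply, h1.fderiv_eq, hessian_apply]
  change fderiv ℝ (fderiv ℝ ρ + (2 * c) • fun y => innerSL ℝ (y - x)) x v w = _
  rw [h4.fderiv]
  simp only [add_apply, smul_apply, smul_eq_mul]
  rfl

variable [FiniteDimensional ℝ E]

/-- The trace over the span of an orthonormal family. -/
theorem traceOn_span_eq_sum {ι : Type*} [Fintype ι] {e : ι → E} (he : Orthonormal ℝ e)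
    (B : LinearMap.BilinForm ℝ E) :
    traceOn (Submodule.span ℝ (Set.range e)) B = ∑ i, B (e i) (e i) := by
  classical
  let b₀ := Module.Basis.span he.linearIndependent
  have hb₀ : ∀ i, (b₀ i : E) = e i := fun i => by simp [b₀, Module.Basis.span_apply]
  have ho : Orthonormal ℝ b₀ := by
    have : Orthonormal ℝ (fun i => ((Submodule.span ℝ (Set.range e)).subtypeₗᵢ (b₀ i))) := by
      simpa [hb₀] using he
    exact (LinearIsometry.orthonormal_comp_iff
      (Submodule.span ℝ (Set.range e)).subtypeₗᵢ).1 this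
  rw [traceOn_eq_sum _ B (b₀.toOrthonormalBasis ho)]
  simp [hb₀]

/-! ### The maximum principle -/

/-- A maximum principle for `p`-plurisubharmonic functions: if the sublevel sets of `g` are
strictly `p`-concave off `K`, then the values on `{g < s}` are controlled by those on `K`. -/
theorem IsPPlurisubharmonicOn.exists_mem_le {p : ℕ} {X G K : Set E} {u g : E → ℝ} {s : ℝ}
    (hX : IsOpen X) (hu : IsPPlurisubharmonicOn p X u) (hG : IsCompact G) (hGX : G ⊆ X)
    (hK : IsCompact K) (hKG : K ⊆ G) (hgG : ContinuousOn g G)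
    (hg : ∀ x ∈ G \ K, g x < s → G ∈ 𝓝 x ∧ ContDiffAt ℝ 2 g x ∧
      ∃ W : Submodule ℝ E, Module.finrank ℝ W = p ∧ (∀ w ∈ W, fderiv ℝ g x w = 0) ∧
        traceOn W (hessian g x) < 0)
    {y : E} (hy : y ∈ G) (hys : g y < s) : ∃ z ∈ K, u y ≤ u z := by
  have huG : ContinuousOn u G := hu.1.continuousOn.mono hGX
  have step : ∀ k : ℝ, 0 < k → ∃ x ∈ K, g x < s ∧
      Real.log (s - g y) + k * u y ≤ Real.log (s - g x) + k * u x := by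
    intro k hk
    -- The product, unlike its logarithm, is continuous on all of `G`; its positive value at `y`
    -- forces `g < s` at a maximum point.
    have hF : ContinuousOn (fun x => (s - g x) * Real.exp (k * u x)) G :=
      (continuousOn_const.sub hgG).mul (Real.continuous_exp.comp_continuousOn
        (continuousOn_const.mul huG))
    obtain ⟨x, hxG, hx⟩ := hG.exists_isMaxOn ⟨y, hy⟩ hF
    have hxs : g x < s := by
      have h1 : 0 < (s - g y) * Real.exp (k * u y) := mul_pos (sub_pos.2 hys) (Real.exp_pos _)
      have h2 := pos_of_mul_pos_left (h1.trans_le (hx hy)) (Real.exp_pos _).le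
      linarith
    have hlog : ∀ z ∈ G, g z < s →
        Real.log (s - g z) + k * u z ≤ Real.log (s - g x) + k * u x := by
      intro z hz hzs
      have h1 : ∀ a, g a < s → Real.log ((s - g a) * Real.exp (k * u a)) =
          Real.log (s - g a) + k * u a := fun a ha => by
        rw [Real.log_mul (sub_pos.2 ha).ne' (Real.exp_pos _).ne', Real.log_exp]
      rw [← h1 z hzs, ← h1 x hxs]
      exact Real.log_le_log (mul_pos (sub_pos.2 hzs) (Real.exp_pos _)) (hx hz)
    refine ⟨x, ?_, hxs, hlog y hy hys⟩
    by_contra hxK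
    obtain ⟨hGx, hgx, W, hW, hWg, hneg⟩ := hg x ⟨hxG, hxK⟩ hxs
    have hux : ContDiffAt ℝ 2 u x :=
      ((hu.1 x (hGX hxG)).contDiffAt (hX.mem_nhds (hGX hxG))).of_le
        (WithTop.coe_le_coe.2 (le_top : (2 : ℕ∞) ≤ ⊤))
    have hmax : IsLocalMax (fun z => Real.log (s - g z) + k * u z) x := by
      filter_upwards [hGx, hgx.continuousAt.eventually (gt_mem_nhds hxs)] with z hz hzs
        using hlog z hz hzs
    have hle : k * traceOn W (hessian u x) ≤ traceOn W (hessian g x) / (s - g x) := by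
      rw [traceOn, traceOn, Finset.mul_sum, Finset.sum_div]
      exact Finset.sum_le_sum fun i _ =>
        hessian_le_of_isLocalMax_log hux hgx hxs hmax (hWg _ (Subtype.coe_prop _))
    have h1 : traceOn W (hessian g x) / (s - g x) < 0 := div_neg_of_neg_of_pos hneg (sub_pos.2 hxs)
    have h2 := mul_nonneg hk.le (hu.2 x (hGX hxG) W hW)
    linarith
  obtain ⟨x₁, hx₁, -⟩ := step 1 one_pos
  obtain ⟨z, hz, hzmax⟩ := hK.exists_isMaxOn ⟨x₁, hx₁⟩ (huG.mono hKG)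
  obtain ⟨m, -, hm⟩ := hG.exists_isMinOn ⟨y, hy⟩ hgG
  refine ⟨z, hz, ?_⟩
  by_contra! hlt
  -- The maximum point depends on `k`, but the bound by the minimum of `g` does not; letting `k`
  -- grow is then contradictory.
  have hbound : ∀ k : ℝ, 0 < k → k * (u y - u z) ≤ Real.log (s - g m) - Real.log (s - g y) := by
    intro k hk
    obtain ⟨x, hx, hxs, h⟩ := step k hk
    have h1 : Real.log (s - g x) ≤ Real.log (s - g m) :=
      Real.log_le_log (sub_pos.2 hxs) (sub_le_sub_left (hm (hKG hx)) s)
    have h2 : k * u x ≤ k * u z := mul_le_mul_of_nonneg_left (hzmax hx) hk.le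
    linarith
  set D := Real.log (s - g m) - Real.log (s - g y) with hD
  have hd : 0 < u y - u z := sub_pos.2 hlt
  have h1 := hbound ((|D| + 1) / (u y - u z)) (by positivity)
  rw [div_mul_cancel₀ _ hd.ne'] at h1
  linarith [le_abs_self D]

/-! ### Stability of strict concavity -/

/-- Strict `p`-concavity of the sublevel set of `g` in the direction of a `p`-plane at one point
persists at nearby points. -/
theorem eventually_exists_traceOn_hessian_neg {g : E → ℝ} {x : E} (hg : ContDiffAt ℝ 2 g x)
    (hgx : fderiv ℝ g x ≠ 0) {W : Submodule ℝ E} (hW : ∀ w ∈ W, fderiv ℝ g x w = 0)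
    (hneg : traceOn W (hessian g x) < 0) :
    ∀ᶠ y in 𝓝 x, ∃ V : Submodule ℝ E, Module.finrank ℝ V = Module.finrank ℝ W ∧
      (∀ v ∈ V, fderiv ℝ g y v = 0) ∧ traceOn V (hessian g y) < 0 := by
  -- `N` is the gradient and `b` the unit normal of the level sets; rotating `b x` to `b y` carries
  -- `W` to a plane tangent at `y`.
  let N : E → E := fun y => (InnerProductSpace.toDual ℝ E).symm (fderiv ℝ g y)
  let b : E → E := fun y => ‖N y‖⁻¹ • N y
  let e := fun i => (stdOrthonormalBasis ℝ W i : E)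
  have hN : ∀ y v, inner ℝ (N y) v = fderiv ℝ g y v := fun y v => by
    simp [N]
  have hf' : ContDiffAt ℝ 1 (fderiv ℝ g) x := hg.fderiv_right (by norm_num)
  have hNc : ContinuousAt N x :=
    (InnerProductSpace.toDual ℝ E).symm.continuous.continuousAt.comp hf'.continuousAt
  have hNx : N x ≠ 0 := by simpa [N] using hgx
  have hbc : ContinuousAt b x := (hNc.norm.inv₀ (by simpa using hNx)).smul hNc
  have hb1 : ∀ y, N y ≠ 0 → ‖b y‖ = 1 := fun y hy => by simp [b, norm_smul, hy]
  have hbx : inner ℝ (b x) (b x) = (1 : ℝ) := by simp [hb1 x hNx]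
  have hbe : ∀ i, inner ℝ (b x) (e i) = (0 : ℝ) := fun i => by
    simp [b, inner_smul_left, hN, e, hW]
  have hdc : ContinuousAt (fun y => 1 + inner ℝ (b x) (b y)) x := by fun_prop
  have hd0 : 1 + inner ℝ (b x) (b x) ≠ (0 : ℝ) := by rw [hbx]; norm_num
  have hrc : ∀ i, ContinuousAt (fun y => rotate (b x) (b y) (e i)) x := fun i => by
    unfold rotate
    exact continuousAt_const.sub
      (((hbc.inner continuousAt_const).div hdc hd0).smul (continuousAt_const.add hbc))
  have hHc : ContinuousAt (fderiv ℝ (fderiv ℝ g)) x :=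
    (hf'.fderiv_right (m := 0) (by norm_num)).continuousAt
  have hsum : ContinuousAt (fun y => ∑ i, hessian g y (rotate (b x) (b y) (e i))
      (rotate (b x) (b y) (e i))) x := by
    simp only [hessian_apply]
    exact tendsto_finsetSum _ fun i _ => (hHc.clm_apply (hrc i)).clm_apply (hrc i)
  have hlt : ∑ i, hessian g x (rotate (b x) (b x) (e i)) (rotate (b x) (b x) (e i)) < 0 := by
    simp only [rotate_self (hbe _)]
    exact hneg
  filter_upwards [hsum.eventually (gt_mem_nhds hlt), hNc.eventually_ne hNx,
    hdc.eventually_ne hd0] with y h1 h2 h3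
  have ho : Orthonormal ℝ (fun i => rotate (b x) (b y) (e i)) := by
    rw [orthonormal_iff_ite]
    intro i j
    rw [inner_rotate_rotate (hb1 x hNx) (hb1 y h2) h3 (hbe i) (hbe j)]
    exact orthonormal_iff_ite.1 (stdOrthonormalBasis ℝ W).orthonormal i j
  refine ⟨Submodule.span ℝ (Set.range fun i => rotate (b x) (b y) (e i)), ?_, ?_, ?_⟩
  · rw [finrank_span_eq_card ho.linearIndependent, Fintype.card_fin]
  · suffices Submodule.span ℝ (Set.range fun i => rotate (b x) (b y) (e i)) ≤
        LinearMap.ker (fderiv ℝ g y : E →ₗ[ℝ] ℝ) from fun v hv => this hv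
    rw [Submodule.span_le]
    rintro _ ⟨i, rfl⟩
    have h4 := inner_rotate (v := e i) (hb1 y h2) h3
    have h5 : N y = ‖N y‖ • b y := by
      simp [b, smul_smul, h2]
    change fderiv ℝ g y (rotate (b x) (b y) (e i)) = 0
    rw [← hN, h5, inner_smul_left, h4, mul_zero]
  · rwa [traceOn_span_eq_sum ho]

/-- Quadratic perturbation of a function whose sublevel set is strictly `p`-concave. -/
theorem exists_perturbation {ρ : E → ℝ} {x : E} (hρ : ContDiffAt ℝ 2 ρ x)
    (hρx : fderiv ℝ ρ x ≠ 0) {W : Submodule ℝ E} (hW : ∀ w ∈ W, fderiv ℝ ρ x w = 0)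
    (hneg : traceOn W (hessian ρ x) < 0) :
    ∃ c > 0, ∀ᶠ y in 𝓝 x, ∃ V : Submodule ℝ E, Module.finrank ℝ V = Module.finrank ℝ W ∧
      (∀ v ∈ V, fderiv ℝ (fun z => ρ z + c * ‖z - x‖ ^ 2) y v = 0) ∧
      traceOn V (hessian (fun z => ρ z + c * ‖z - x‖ ^ 2) y) < 0 := by
  set T := traceOn W (hessian ρ x) with hT
  set d : ℝ := ((Module.finrank ℝ W : ℕ) : ℝ) with hd
  have hd0 : 0 ≤ d := Nat.cast_nonneg _
  -- The perturbation adds `2 c d = -T d / (d + 1) < -T` to the trace, which stays negative.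
  let c := -T / (2 * (d + 1))
  have hc : 0 < c := div_pos (neg_pos.2 hneg) (by positivity)
  have hf : fderiv ℝ (fun z => ρ z + c * ‖z - x‖ ^ 2) x = fderiv ℝ ρ x := by
    rw [fderiv_add_mul_norm_sq (hρ.differentiableAt (by simp))]
    simp
  refine ⟨c, hc, eventually_exists_traceOn_hessian_neg ?_ (by rwa [hf]) (by rwa [hf]) ?_⟩
  · exact hρ.add (contDiffAt_const.mul ((contDiffAt_id.sub contDiffAt_const).norm_sq ℝ))
  · have h1 : ∀ i, inner ℝ (stdOrthonormalBasis ℝ W i : E) (stdOrthonormalBasis ℝ W i : E)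
        = (1 : ℝ) := fun i => by
      have := (stdOrthonormalBasis ℝ W).orthonormal.1 i
      rw [real_inner_self_eq_norm_sq, ← Submodule.coe_norm, this, one_pow]
    have h2 : traceOn W (hessian (fun z => ρ z + c * ‖z - x‖ ^ 2) x) = T + d * (2 * c) := by
      rw [hT, traceOn, traceOn]
      simp only [hessian_add_mul_norm_sq hρ, h1, Finset.sum_add_distrib]
      simp [hd]
    rw [h2]
    have h3 : d * (2 * c) = -T * (d / (d + 1)) := by simp only [c]; field_simp
    have h4 : d / (d + 1) < 1 := by rw [div_lt_one (by positivity)]; linarith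
    rw [h3]
    nlinarith

/-! ### Tangent cone, normal and second fundamental form -/

/-- The tangent cone of a regular level set is the kernel of the differential. -/
theorem mem_tangentConeAt_level_iff {S : Set E} {ρ : E → ℝ} {x v : E} (hρ : ContDiffAt ℝ 1 ρ x)
    (hS : ∀ᶠ y in 𝓝 x, y ∈ S ↔ ρ y = 0) (hx : ρ x = 0) (hρx : fderiv ℝ ρ x ≠ 0) :
    v ∈ tangentConeAt ℝ S x ↔ fderiv ℝ ρ x v = 0 := by
  have hstrict : HasStrictFDerivAt ρ (fderiv ℝ ρ x) x := hρ.hasStrictFDerivAt (by simp)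
  constructor
  · intro hv
    -- `ρ` vanishes on `S`, and derivatives within `S` agree on its tangent cone.
    have h0 : HasFDerivWithinAt ρ (0 : E →L[ℝ] ℝ) S x := by
      refine (hasFDerivWithinAt_const (0 : ℝ) x S).congr_of_eventuallyEq ?_ hx
      filter_upwards [nhdsWithin_le_nhds hS, self_mem_nhdsWithin] with y h1 h2 using h1.1 h2
    simpa using hstrict.hasFDerivAt.hasFDerivWithinAt.unique_on h0 hv
  · intro hv
    have hsurj : (fderiv ℝ ρ x).range = ⊤ :=
      LinearMap.range_eq_top.2 (LinearMap.surjective fun h => hρx (by ext w; exact congr($h w)))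
    -- The curve `t ↦ φ (t • w)` stays in the level set and has velocity `v` at `0`.
    let φ := hstrict.implicitFunction ρ (fderiv ℝ ρ x) hsurj (ρ x)
    have hφ : HasStrictFDerivAt φ (fderiv ℝ ρ x).ker.subtypeL 0 :=
      hstrict.to_implicitFunction hsurj
    have hφ0 : φ 0 = x := hstrict.implicitFunction_apply_image hsurj
    have hmap : ∀ᶠ w in 𝓝 (0 : (fderiv ℝ ρ x).ker), ρ (φ w) = ρ x := by
      have h := hstrict.map_implicitFunction_eq hsurj
      have hc : Tendsto (fun w : (fderiv ℝ ρ x).ker => (ρ x, w)) (𝓝 0) (𝓝 (ρ x, 0)) :=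
        (Continuous.prodMk continuous_const continuous_id).tendsto 0
      exact hc.eventually h
    let w : (fderiv ℝ ρ x).ker := ⟨v, hv⟩
    have hline : Tendsto (fun t : ℝ => t • w) (𝓝 0) (𝓝 0) := by
      have : Continuous fun t : ℝ => t • w := by fun_prop
      simpa using this.tendsto 0
    have hline' : HasDerivAt (fun t : ℝ => t • w) w 0 := by
      simpa using (hasDerivAt_id (0 : ℝ)).smul_const w
    have hγ : HasDerivAt (fun t : ℝ => φ (t • w)) v 0 := by
      have h1 : HasFDerivAt φ (fderiv ℝ ρ x).ker.subtypeL ((0 : ℝ) • w) := by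
        rw [zero_smul]; exact hφ.hasFDerivAt
      exact h1.comp_hasDerivAt 0 hline'
    have hslope := hγ.tendsto_slope
    have hγ0 : Tendsto (fun t : ℝ => φ (t • w)) (𝓝[≠] 0) (𝓝 x) := by
      have := hγ.continuousAt.tendsto
      rw [zero_smul, hφ0] at this
      exact this.mono_left nhdsWithin_le_nhds
    refine mem_tangentConeAt_of_seq (𝓝[≠] (0 : ℝ)) (fun t => t⁻¹) (fun t => φ (t • w) - x)
      ?_ ?_ ?_
    · simpa using hγ0.sub_const x
    · filter_upwards [hγ0.eventually hS, nhdsWithin_le_nhds (hline.eventually hmap)] with t h1 h2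
      rw [add_sub_cancel]
      exact h1.2 (h2.trans hx)
    · refine hslope.congr fun t => ?_
      simp [slope, hφ0]

/-- The inward unit normal at a boundary point, in terms of a defining function. -/
theorem isInwardUnitNormal_iff {Ω : Set E} {ρ : E → ℝ} {x ν : E} (hρ : ContDiffAt ℝ 1 ρ x)
    (hΩ : ∀ᶠ y in 𝓝 x, y ∈ Ω ↔ ρ y < 0) (hS : ∀ᶠ y in 𝓝 x, y ∈ frontier Ω ↔ ρ y = 0)
    (hx : ρ x = 0) (hρx : fderiv ℝ ρ x ≠ 0) :
    IsInwardUnitNormal Ω x ν ↔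
      ν = -(‖fderiv ℝ ρ x‖⁻¹ • (InnerProductSpace.toDual ℝ E).symm (fderiv ℝ ρ x)) := by
  set N := (InnerProductSpace.toDual ℝ E).symm (fderiv ℝ ρ x) with hN
  have hNv : ∀ v, inner ℝ N v = fderiv ℝ ρ x v := fun v => by simp [hN]
  have hNn : ‖fderiv ℝ ρ x‖ = ‖N‖ := by simp [hN]
  have hN0 : 0 < ‖N‖ := by rw [← hNn]; exact norm_pos_iff.2 hρx
  rw [hNn]
  have hderiv : ∀ v, HasDerivAt (fun t : ℝ => ρ (x + t • v)) (inner ℝ N v) 0 := by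
    intro v
    have h1 : HasDerivAt (fun t : ℝ => x + t • v) v 0 := by
      simpa using ((hasDerivAt_id (0 : ℝ)).smul_const v).const_add x
    have h2 : HasFDerivAt ρ (fderiv ℝ ρ x) (x + (0 : ℝ) • v) := by
      rw [zero_smul, add_zero]; exact (hρ.differentiableAt (by simp)).hasFDerivAt
    rw [hNv]
    exact h2.comp_hasDerivAt 0 h1
  have hline : ∀ v, Tendsto (fun t : ℝ => x + t • v) (𝓝[>] 0) (𝓝 x) := by
    intro v
    have : Continuous fun t : ℝ => x + t • v := by fun_prop
    have h := this.tendsto 0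
    rw [zero_smul, add_zero] at h
    exact h.mono_left nhdsWithin_le_nhds
  have hslope : ∀ v, Tendsto (fun t : ℝ => t⁻¹ * ρ (x + t • v)) (𝓝[>] 0) (𝓝 (inner ℝ N v)) := by
    intro v
    refine ((hderiv v).tendsto_slope.mono_left
      (nhdsWithin_mono _ fun t (ht : 0 < t) => ht.ne')).congr fun t => ?_
    simp [slope, hx]
  have hNN : inner ℝ N N = ‖N‖ * ‖N‖ := real_inner_self_eq_norm_mul_norm N
  constructor
  · rintro ⟨h1, h2, h3⟩
    have hperp : ∀ v, inner ℝ N v = 0 → inner ℝ ν v = 0 := fun v hv =>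
      h2 v ((mem_tangentConeAt_level_iff hρ hS hx hρx).2 ((hNv v).symm.trans hv))
    set a := inner ℝ N ν / (‖N‖ * ‖N‖) with ha
    have hνa : ν = a • N := by
      -- `ν - a • N` is tangent, hence orthogonal to `ν` as well as to `N`, and so to itself.
      have h4 : inner ℝ N (ν - a • N) = 0 := by
        rw [inner_sub_right, inner_smul_right, hNN, ha]
        field_simp
        simp
      have h5 := hperp _ h4
      have h6 : inner ℝ (ν - a • N) (ν - a • N) = (0 : ℝ) := by
        rw [inner_sub_left, inner_smul_left, h4, h5]; simp
      exact sub_eq_zero.1 (inner_self_eq_zero.1 h6)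
    have hle : inner ℝ N ν ≤ (0 : ℝ) := by
      refine le_of_tendsto (hslope ν) ?_
      filter_upwards [h3, (hline ν).eventually hΩ, self_mem_nhdsWithin] with t h4 h5 h6
      exact mul_nonpos_of_nonneg_of_nonpos (inv_nonneg.2 (le_of_lt h6)) (h5.1 h4).le
    have ha0 : a ≤ 0 := div_nonpos_of_nonpos_of_nonneg hle (by positivity)
    have hna : -a * ‖N‖ = 1 := by
      rw [hνa, norm_smul, Real.norm_eq_abs, abs_of_nonpos ha0] at h1
      exact h1
    have : a = -‖N‖⁻¹ := by
      field_simp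
      linarith
    rw [hνa, this, neg_smul]
  · rintro rfl
    refine ⟨?_, ?_, ?_⟩
    · rw [norm_neg, norm_smul, norm_inv, norm_norm, inv_mul_cancel₀ hN0.ne']
    · intro v hv
      rw [inner_neg_left, inner_smul_left, hNv,
        (mem_tangentConeAt_level_iff hρ hS hx hρx).1 hv]
      simp
    · have hneg : inner ℝ N (-(‖N‖⁻¹ • N)) < (0 : ℝ) := by
        rw [inner_neg_right, inner_smul_right, hNN]
        have : 0 < ‖N‖⁻¹ * (‖N‖ * ‖N‖) := by positivity
        linarith
      filter_upwards [(hslope _).eventually (gt_mem_nhds hneg), (hline _).eventually hΩ,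
        self_mem_nhdsWithin] with t h1 h2 h3
      exact h2.2 (neg_of_mul_neg_right h1 (inv_nonneg.2 (le_of_lt h3)))

theorem inwardNormal_eq {Ω : Set E} {ρ : E → ℝ} {x : E} (hρ : ContDiffAt ℝ 1 ρ x)
    (hΩ : ∀ᶠ y in 𝓝 x, y ∈ Ω ↔ ρ y < 0) (hS : ∀ᶠ y in 𝓝 x, y ∈ frontier Ω ↔ ρ y = 0)
    (hx : ρ x = 0) (hρx : fderiv ℝ ρ x ≠ 0) :
    inwardNormal Ω x =
      -(‖fderiv ℝ ρ x‖⁻¹ • (InnerProductSpace.toDual ℝ E).symm (fderiv ℝ ρ x)) := by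
  have h : ∃ ν, IsInwardUnitNormal Ω x ν := ⟨_, (isInwardUnitNormal_iff hρ hΩ hS hx hρx).2 rfl⟩
  rw [inwardNormal, dif_pos h]
  exact (isInwardUnitNormal_iff hρ hΩ hS hx hρx).1 h.choose_spec

/-- The second fundamental form on tangent vectors, in terms of a defining function. -/
theorem secondFundamentalForm_eq {Ω : Set E} {ρ : E → ℝ} {x v w : E} (hρ : ContDiffAt ℝ 2 ρ x)
    (hΩ : ∀ᶠ y in 𝓝 x, y ∈ Ω ↔ ρ y < 0) (hS : ∀ᶠ y in 𝓝 x, y ∈ frontier Ω ↔ ρ y = 0)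
    (hx : ρ x = 0) (hρx : fderiv ℝ ρ x ≠ 0) (hv : v ∈ tangentConeAt ℝ (frontier Ω) x)
    (hw : w ∈ tangentConeAt ℝ (frontier Ω) x) :
    secondFundamentalForm Ω x v w = ‖fderiv ℝ ρ x‖⁻¹ * hessian ρ x v w := by
  let J : (E →L[ℝ] ℝ) →L[ℝ] E :=
    { toFun := (InnerProductSpace.toDual ℝ E).symm
      map_add' := map_add _
      map_smul' := fun c L => by simp
      cont := (InnerProductSpace.toDual ℝ E).symm.continuous }
  have hJdef : ∀ L, J L = (InnerProductSpace.toDual ℝ E).symm L := fun _ => rfl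
  have hJ : ∀ L u, inner ℝ (J L) u = L u := fun L u => by simp [hJdef]
  let n : E → E := fun y => -(‖fderiv ℝ ρ y‖⁻¹ • J (fderiv ℝ ρ y))
  have hf' : ContDiffAt ℝ 1 (fderiv ℝ ρ) x := hρ.fderiv_right (by norm_num)
  have hd : DifferentiableAt ℝ (fderiv ℝ ρ) x := hf'.differentiableAt (by simp)
  have heq : inwardNormal Ω =ᶠ[𝓝[frontier Ω] x] n := by
    filter_upwards [nhdsWithin_le_nhds (hρ.eventually (by simp)),
      nhdsWithin_le_nhds hΩ.eventually_nhds, nhdsWithin_le_nhds hS.eventually_nhds,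
      nhdsWithin_le_nhds (hf'.continuousAt.eventually_ne hρx), self_mem_nhdsWithin]
      with y h1 h2 h3 h4 h5
    exact inwardNormal_eq (h1.of_le (by norm_num)) h2 h3 (h3.self_of_nhds.1 h5) h4
  have hJd : HasFDerivAt (fun y => J (fderiv ℝ ρ y)) (J ∘L fderiv ℝ (fderiv ℝ ρ) x) x :=
    J.hasFDerivAt.comp x hd.hasFDerivAt
  have hcd : DifferentiableAt ℝ (fun y => ‖fderiv ℝ ρ y‖⁻¹) x := by
    have h1 : (fun y => ‖fderiv ℝ ρ y‖⁻¹) = fun y => ‖J (fderiv ℝ ρ y)‖⁻¹ := by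
      funext y; simp [hJdef]
    have h2 : J (fderiv ℝ ρ x) ≠ 0 := by simpa [hJdef] using hρx
    rw [h1]
    exact (hJd.differentiableAt.norm ℝ h2).inv (by simpa using h2)
  have hnd := (hcd.hasFDerivAt.smul hJd).neg
  have hxS : x ∈ frontier Ω := hS.self_of_nhds.2 hx
  have hwithin : HasFDerivWithinAt (inwardNormal Ω) _ (frontier Ω) x :=
    hnd.hasFDerivWithinAt.congr_of_eventuallyEq heq (heq.self_of_nhdsWithin hxS)
  -- Derivatives within `∂Ω` are determined only on tangent vectors, hence the use of `hv`.
  have hval := hwithin.differentiableWithinAt.hasFDerivWithinAt.unique_on hwithin hv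
  have hw0 := (mem_tangentConeAt_level_iff (hρ.of_le (by norm_num)) hS hx hρx).1 hw
  change -inner ℝ (fderivWithin ℝ (inwardNormal Ω) (frontier Ω) x v) w = _
  rw [hval]
  -- The derivative of the factor `‖dρ‖⁻¹` multiplies the gradient, which is orthogonal to `w`.
  simp [inner_add_left, inner_smul_left, inner_neg_left, hJ, hw0, hessian_apply]

/-! ### Contradiction with local convexity -/

/-- A sublevel set is not locally `p`-convex near a boundary point at which the Hessian of the
defining function has negative trace on a tangent `p`-plane. -/
theorem traceOn_hessian_nonneg_of_isPConvex {p : ℕ} {Ω U : Set E} {ρ : E → ℝ} {x : E}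
    (hΩ : IsOpen Ω) (hU : IsOpen U) (hxU : x ∈ U) (hconv : IsPConvex p (Ω ∩ U))
    (hρ : ContDiffAt ℝ 2 ρ x) (hρΩ : ∀ᶠ y in 𝓝 x, y ∈ Ω ↔ ρ y < 0) (hx : ρ x = 0)
    (hρx : fderiv ℝ ρ x ≠ 0) {W : Submodule ℝ E} (hWp : Module.finrank ℝ W = p)
    (hW : ∀ w ∈ W, fderiv ℝ ρ x w = 0) : 0 ≤ traceOn W (hessian ρ x) := by
  by_contra! hneg
  obtain ⟨c, hc, hV⟩ := exists_perturbation hρ hρx hW hneg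
  rw [hWp] at hV
  set g : E → ℝ := fun z => ρ z + c * ‖z - x‖ ^ 2 with hg
  obtain ⟨r₀, hr₀, hball⟩ := Metric.eventually_nhds_iff_ball.1
    (((hρ.eventually (by simp)).and hρΩ).and (hV.and (hU.mem_nhds hxU)))
  set r := r₀ / 2 with hr
  have hr0 : 0 < r := half_pos hr₀
  have hsub : Metric.closedBall x r ⊆ Metric.ball x r₀ :=
    Metric.closedBall_subset_ball (half_lt_self hr₀)
  have hρc : ContinuousOn ρ (Metric.closedBall x r) := fun y hy =>
    (hball y (hsub hy)).1.1.continuousAt.continuousWithinAt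
  have hgd : ∀ y ∈ Metric.closedBall x r, ContDiffAt ℝ 2 g y := fun y hy =>
    (hball y (hsub hy)).1.1.add
      (contDiffAt_const.mul ((contDiffAt_id.sub contDiffAt_const).norm_sq ℝ))
  have hgc : ContinuousOn g (Metric.closedBall x r) := fun y hy =>
    (hgd y hy).continuousAt.continuousWithinAt
  have hρg : ∀ y, ρ y ≤ g y := fun y => by
    have : 0 ≤ c * ‖y - x‖ ^ 2 := by positivity
    simp only [hg]; linarith
  have hsublevel : ∀ f : E → ℝ, ContinuousOn f (Metric.closedBall x r) → ∀ a : ℝ,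
      IsCompact (Metric.closedBall x r ∩ f ⁻¹' Iic a) := fun f hf a =>
    (isCompact_closedBall x r).of_isClosed_subset
      (hf.preimage_isClosed_of_isClosed Metric.isClosed_closedBall isClosed_Iic)
      inter_subset_left
  have hmem : ∀ y ∈ Metric.closedBall x r, ρ y < 0 → y ∈ Ω ∩ U := fun y hy h =>
    ⟨(hball y (hsub hy)).1.2.2 h, (hball y (hsub hy)).2.2⟩
  set K := Metric.closedBall x r ∩ ρ ⁻¹' Iic (-(c * r ^ 2)) with hK
  have hKc : IsCompact K := hsublevel ρ hρc _
  have hcr : 0 < c * r ^ 2 := by positivity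
  have hKX : K ⊆ Ω ∩ U := fun y hy =>
    hmem y hy.1 (lt_of_le_of_lt hy.2 (neg_neg_of_pos hcr))
  have hhull : ∀ y ∈ Metric.closedBall x r, g y < 0 → y ∈ pHull p (Ω ∩ U) K := by
    intro y hy hgy
    refine ⟨hmem y hy ((hρg y).trans_lt hgy), fun u hu => ?_⟩
    -- The level satisfies `g y < g y / 2 < 0`: `y` lies strictly below it, and `G` stays inside `{ρ
    -- < 0}`.
    set G := Metric.closedBall x r ∩ g ⁻¹' Iic (g y / 2) with hG
    have hGc : IsCompact G := hsublevel g hgc _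
    obtain ⟨z, hz, hzu⟩ := hu.exists_mem_le (s := g y / 2) (hΩ.inter hU) hGc
      (fun z hz => hmem z hz.1 (((hρg z).trans hz.2).trans_lt (by linarith)))
      (hKc.inter hGc) inter_subset_right (hgc.mono inter_subset_left)
      (by
        rintro z ⟨hzG, hzK⟩ hzs
        refine ⟨?_, hgd z hzG.1, (hball z (hsub hzG.1)).2.1⟩
        -- On the sphere `g = ρ + c r²`, so a point of `G` there would lie in `K`.
        have hzb : z ∈ Metric.ball x r := by
          refine lt_of_le_of_ne (Metric.mem_closedBall.1 hzG.1) fun hzr => hzK ⟨⟨hzG.1, ?_⟩, hzG⟩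
          have h1 : ‖z - x‖ = r := by rw [← dist_eq_norm]; exact hzr
          have h2 : g z = ρ z + c * r ^ 2 := by simp only [hg, h1]
          change ρ z ≤ -(c * r ^ 2)
          linarith
        filter_upwards [Metric.isOpen_ball.mem_nhds hzb,
          (hgd z hzG.1).continuousAt.eventually (gt_mem_nhds hzs)] with a ha ha'
        exact ⟨Metric.ball_subset_closedBall ha, ha'.le⟩)
      (show y ∈ G from ⟨hy, by change g y ≤ g y / 2; linarith⟩) (by linarith)
    exact (EReal.coe_le_coe_iff.2 hzu).trans (le_iSup₂ (f := fun a _ => (u a : EReal)) z hz.1)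
  have hxΩ : x ∉ pHull p (Ω ∩ U) K := fun h => by
    have := hρΩ.self_of_nhds.1 h.1.1
    linarith
  have hgx : g x = 0 := by simp [hg, hx]
  have hmin : IsLocalMin g x := by
    filter_upwards [(hconv K hKX hKc).isClosed.isOpen_compl.mem_nhds hxΩ,
      Metric.closedBall_mem_nhds x hr0] with y hy hyb
    rw [hgx]
    exact not_lt.1 fun h => hy (hhull y hyb h)
  apply hρx
  have h0 := hmin.fderiv_eq_zero
  rw [hg, fderiv_add_mul_norm_sq (hρ.differentiableAt (by simp))] at h0
  simpa using h0

end PConvexity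

end

theorem theorem3p9 (n p : ℕ) (hp : 1 ≤ p) (hpn : p ≤ n)
    (Ω : Set (EuclideanSpace ℝ (Fin n))) (hΩ : IsOpen Ω)
    (hsmooth : PConvexity.HasSmoothBoundary Ω)
    (hloc : PConvexity.IsLocallyPConvex p Ω) :
    ∀ x ∈ frontier Ω, PConvexity.BoundaryPConvexAt p Ω x := by
  intro x hx W hWp hWT
  obtain ⟨B, ρ, hB, hxB, hρB, hBΩ, hBS, hdρ⟩ := hsmooth x hx
  obtain ⟨U, hU, hxU, hconv⟩ := hloc x hx
  have hBx : B ∈ 𝓝 x := hB.mem_nhds hxB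
  have hρ : ContDiffAt ℝ 2 ρ x :=
    (hρB.contDiffAt hBx).of_le (WithTop.coe_le_coe.2 (le_top : (2 : ℕ∞) ≤ ⊤))
  have hxρ : ρ x = 0 := (hBS x hxB).1 hx
  have hΩ' : ∀ᶠ y in 𝓝 x, y ∈ Ω ↔ ρ y < 0 := by filter_upwards [hBx] using hBΩ
  have hS' : ∀ᶠ y in 𝓝 x, y ∈ frontier Ω ↔ ρ y = 0 := by filter_upwards [hBx] using hBS
  have hne := hdρ x hxB hx
  have hker : ∀ w ∈ W, fderiv ℝ ρ x w = 0 := fun w hw =>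
    (PConvexity.mem_tangentConeAt_level_iff (hρ.of_le (by norm_num)) hS' hxρ hne).1 (hWT hw)
  have htrace : PConvexity.traceOn W (PConvexity.secondFundamentalForm Ω x) =
      ‖fderiv ℝ ρ x‖⁻¹ * PConvexity.traceOn W (PConvexity.hessian ρ x) := by
    rw [PConvexity.traceOn, PConvexity.traceOn, Finset.mul_sum]
    refine Finset.sum_congr rfl fun i _ => ?_
    exact PConvexity.secondFundamentalForm_eq hρ hΩ' hS' hxρ hne
      (hWT (Subtype.coe_prop _)) (hWT (Subtype.coe_prop _))
  rw [htrace]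
  exact mul_nonneg (inv_nonneg.2 (norm_nonneg _))
    (PConvexity.traceOn_hessian_nonneg_of_isPConvex hΩ hU hxU hconv hρ hΩ' hxρ hne hWp hker)
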